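/- **Conventions.** A \emph{finite partial automorphism} of a group $\Gamma$ is an isomorphism $p\colon A\to B$ between finitely generated subgroups $A,B\le\Gamma$. The group $\Gamma$ is \emph{inner ultrahomogeneous} if for every finite partial automorphism $p\colon A\to B$ of $\Gamma$ there is $g\in\Gamma$ such that $g^{-1}ag=p(a)$ for all $a\in A$. The \emph{age} $\operatorname{Age}(\Gamma)$ is the class of all finitely generated groups which embed into $\Gamma$. It is \emph{closed under $\times$} if $A\times B\in\operatorname{Age}(\Gamma)$ for all $A,B\in\operatorname{Age}(\Gamma)$, and \emph{closed under $\times\mathbf Z$} if $A\times\mathbf Z\in\operatorname{Age}(\Gamma)$ for all $A\in\operatorname{Age}(\Gamma)$. The group $\operatorname{Aut}(\Gamma)$ carries its usual group topology, in which the pointwise stabilisers of finite subsets of $\Gamma$ form a basis of neighbourhoods of the identity. **Theorem.** Let $\Gamma$ be a countable (possibly finite) inner ultrahomogeneous group such that $\operatorname{Age}(\Gamma)$ is closed under $\times$ or closed under $\times\mathbf Z$. Then $\Gamma$ has ample generic automorphisms: for every $n\in\mathbf N$ there is a tuple $(g_1,\dots,g_n)\in\operatorname{Aut}(\Gamma)^n$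 whose orbit $$\{(k^{-1}g_1k,\dots,k^{-1}g_nk) : k\in\operatorname{Aut}(\Gamma)\}$$ under the diagonal conjugation action is comeagre in $\operatorname{Aut}(\Gamma)^n$ with the product topology. -/

import Mathlib

open Topology

universe u v

/-- A group `Γ` is inner ultrahomogeneous if every finite partial automorphism of `Γ`, that is,
every isomorphism `p : A ≃* B` between finitely generated subgroups of `Γ`, is given by conjugation
`a ↦ a ^ g = g⁻¹ a g` by some element `g` of `Γ`. -/
def IsInnerUltrahomogeneous (Γ : Type u) [Group Γ] : Prop :=
  ∀ (A B : Subgroup Γ), A.FG → B.FG → ∀ p : A ≃* B,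
    ∃ g : Γ, ∀ a : A, g⁻¹ * (a : Γ) * g = (p a : Γ)

/-- `InAge Γ A` says that the group `A` belongs to the age of `Γ`: it is finitely generated and
embeds into `Γ`. -/
def InAge (Γ : Type u) [Group Γ] (A : Type v) [Group A] : Prop :=
  Group.FG A ∧ ∃ f : A →* Γ, Function.Injective f

/-- The age of `Γ` is closed under binary direct products. -/
def AgeClosedUnderProd (Γ : Type u) [Group Γ] : Prop :=
  ∀ (A B : Type u) [Group A] [Group B], InAge Γ A → InAge Γ B → InAge Γ (A × B)

/-- The age of `Γ` is closed under direct products with the infinite cyclic group `ℤ`. -/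
def AgeClosedUnderProdInt (Γ : Type u) [Group Γ] : Prop :=
  ∀ (A : Type u) [Group A], InAge Γ A → InAge Γ (A × Multiplicative ℤ)

/-- The orbit of the tuple `g` under the diagonal action of `G` on `Gⁿ` by conjugation. -/
def diagConjOrbit {G : Type u} [Group G] {n : ℕ} (g : Fin n → G) : Set (Fin n → G) :=
  Set.range fun (k : G) (i : Fin n) => k⁻¹ * g i * k

/-- A tuple in a topological group `G` is generic if its diagonal conjugacy orbit is comeagre in
`Gⁿ` (with the product topology). -/
def IsGenericTuple {G : Type u} [Group G] [TopologicalSpace G] [IsTopologicalGroup G] {n : ℕ}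
    (g : Fin n → G) : Prop :=
  diagConjOrbit g ∈ residual (Fin n → G)

/-- A topological group has ample generics if it has a generic `n`-tuple for every `n`. -/
def HasAmpleGenerics (G : Type u) [Group G] [TopologicalSpace G] [IsTopologicalGroup G] : Prop :=
  ∀ n : ℕ, ∃ g : Fin n → G, IsGenericTuple g

/-- The usual topology on `Aut(Γ)`: it is generated by the cosets `τ · Stab(S)` of the pointwise
stabilisers of finite sets `S ⊆ Γ`. -/
instance autTopology (Γ : Type u) [Group Γ] : TopologicalSpace (MulAut Γ) :=
  TopologicalSpace.generateFrom
    {U | ∃ (τ : MulAut Γ) (S : Finset Γ), U = {σ : MulAut Γ | ∀ a ∈ S, σ a = τ a}}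

/-- The pointwise stabilisers of finite sets form a neighbourhood basis (translated to `τ`). -/
theorem autTopology_nhds_hasBasis (Γ : Type u) [Group Γ] (τ : MulAut Γ) :
    (𝓝 τ).HasBasis (fun _ : Finset Γ => True) (fun S => {σ : MulAut Γ | ∀ a ∈ S, σ a = τ a}) := by
  classical
  have hB : TopologicalSpace.IsTopologicalBasis
      {U | ∃ (τ : MulAut Γ) (S : Finset Γ), U = {σ : MulAut Γ | ∀ a ∈ S, σ a = τ a}} := by
    refine ⟨?_, ?_, rfl⟩
    · rintro _ ⟨τ₁, S₁, rfl⟩ _ ⟨τ₂, S₂, rfl⟩ ρ ⟨h₁, h₂⟩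
      refine ⟨_, ⟨ρ, S₁ ∪ S₂, rfl⟩, fun a _ => rfl, fun σ hσ => ⟨fun a ha => ?_, fun a ha => ?_⟩⟩
      · rw [hσ a (Finset.mem_union_left _ ha), h₁ a ha]
      · rw [hσ a (Finset.mem_union_right _ ha), h₂ a ha]
    · exact Set.eq_univ_of_forall fun ρ =>
        ⟨_, ⟨ρ, ∅, rfl⟩, fun a _ => rfl⟩
  refine ⟨fun t => ?_⟩
  rw [hB.mem_nhds_iff]
  constructor
  · rintro ⟨_, ⟨ρ, S, rfl⟩, hτ, hsub⟩
    exact ⟨S, trivial, fun σ hσ => hsub fun a ha => (hσ a ha).trans (hτ a ha)⟩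
  · rintro ⟨S, -, hsub⟩
    exact ⟨_, ⟨τ, S, rfl⟩, fun a _ => rfl, hsub⟩

instance autTopology_isTopologicalGroup (Γ : Type u) [Group Γ] :
    IsTopologicalGroup (MulAut Γ) where
  continuous_mul := by
    classical
    rw [continuous_iff_continuousAt]
    rintro ⟨σ, τ⟩
    rw [ContinuousAt, nhds_prod_eq,
      ((autTopology_nhds_hasBasis Γ σ).prod (autTopology_nhds_hasBasis Γ τ)).tendsto_iff
        (autTopology_nhds_hasBasis Γ (σ * τ))]
    intro S _
    refine ⟨(S.image τ, S), ⟨trivial, trivial⟩, ?_⟩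
    rintro ⟨σ', τ'⟩ ⟨h₁, h₂⟩ a ha
    change σ' (τ' a) = σ (τ a)
    rw [h₂ a ha]
    exact h₁ _ (Finset.mem_image_of_mem _ ha)
  continuous_inv := by
    classical
    rw [continuous_iff_continuousAt]
    intro σ
    rw [ContinuousAt,
      (autTopology_nhds_hasBasis Γ σ).tendsto_iff (autTopology_nhds_hasBasis Γ σ⁻¹)]
    intro S _
    refine ⟨S.image (fun a => σ⁻¹ a), trivial, fun σ' h a ha => ?_⟩
    have h₁ := h _ (Finset.mem_image_of_mem _ ha)
    rw [MulAut.apply_inv_self] at h₁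
    change σ'⁻¹ a = σ⁻¹ a
    nth_rewrite 1 [← h₁]
    exact MulAut.inv_apply_self _ _ _

/-- `Γ` has ample generic automorphisms if the topological group `Aut(Γ)` has ample generics. -/
def HasAmpleGenericAutomorphisms (Γ : Type u) [Group Γ] : Prop :=
  HasAmpleGenerics (MulAut Γ)

/-! Inner ultrahomogeneity makes inner automorphisms dense, so a finite piece of a tuple of
automorphisms can be coded by a finitely generated subgroup `A` and elements `g i` of `A` acting by
conjugation. Two properties of a tuple are comeagre: `IsLocallyInner` (such pieces exhaust the
group) and `IsExtensive` (every extension of a piece is realized). A back-and-forth argument,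
`exists_conj_of_isExtensive`, conjugates any two tuples having both, so these tuples lie in a single
comeagre orbit.

The crux is density of the extension property, which rests on
`IsInnerUltrahomogeneous.exists_amalgam`. Let `(B, h)` and `(C, k)` extend `(A, g)`. Amalgamating
`B` and `C` over `A` is not enough, because `h i` and `k i` act alike on `A` but need not be equal.
Their differences `(g i)⁻¹ * h i` and `(g i)⁻¹ * k i` centralise `A`. Choose a group `L` with
elements `l i` mapping to both differences. The shears `(a, x) ↦ (a φ(x), x)` and `(a, x) ↦ (a ψ(x),
x)` embed `A × L` into `B × L` and `C × L`, taking `(g i, l i)` to `(h i, l i)` and `(k i, l i)`.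
Gluing over `A × L` inside `Γ` makes these two elements equal, and the result acts on `B` as `h i`
and on `C` as `k i`.

For an age closed under products, `L` can be a subgroup of `B × C`. For closure under products with
`ℤ`, `L` is free of rank `n`: a faithful action on `ℤ²`, realized by conjugation in `Γ`, puts `B ×
L` in the age. -/

/-- In an inner ultrahomogeneous group, any two embeddings of a finitely generated group are
conjugate. -/
theorem IsInnerUltrahomogeneous.exists_conj_eq {Γ : Type u} [Group Γ]
    (hΓ : IsInnerUltrahomogeneous Γ) {A : Type v} [Group A] (hA : Group.FG A) (f f' : A →* Γ)
    (hf : Function.Injective f) (hf' : Function.Injective f') :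
    ∃ e : Γ, ∀ a, e⁻¹ * f a * e = f' a := by
  have hfg (g : A →* Γ) : g.range.FG := by
    rw [← Group.fg_iff_subgroup_fg]
    infer_instance
  obtain ⟨e, he⟩ := hΓ f.range f'.range (hfg f) (hfg f')
    ((MonoidHom.ofInjective hf).symm.trans (MonoidHom.ofInjective hf'))
  refine ⟨e, fun a => ?_⟩
  simpa [MonoidHom.ofInjective_apply] using he (MonoidHom.ofInjective hf a)

theorem InAge.of_injective {Γ : Type u} [Group Γ] {A B : Type*} [Group A] [Group B]
    (hB : InAge Γ B) (hA : Group.FG A) (f : A →* B) (hf : Function.Injective f) : InAge Γ A := by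
  obtain ⟨-, g, hg⟩ := hB
  exact ⟨hA, g.comp f, hg.comp hf⟩

theorem InAge.of_subgroup {Γ : Type u} [Group Γ] {A : Subgroup Γ} (hA : A.FG) : InAge Γ A :=
  ⟨(Group.fg_iff_subgroup_fg A).2 hA, A.subtype, A.subtype_injective⟩

/-! ### Free factors from faithful actions on `ℤ²` -/

/-- If `B × V` is in the age of an inner ultrahomogeneous group, where `V` has a faithful action by
automorphisms of the free group `F` on `ι`, then `B × F` embeds into the group. -/
theorem IsInnerUltrahomogeneous.exists_embedding_prod_freeGroup {Γ : Type u} [Group Γ]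
    (hΓ : IsInnerUltrahomogeneous Γ) {B V ι : Type*} [Group B] [Group V]
    (hBV : InAge Γ (B × V)) (ρ : FreeGroup ι →* MulAut V) (hρ : Function.Injective ρ) :
    ∃ f : B × FreeGroup ι →* Γ, Function.Injective f := by
  obtain ⟨hfg, f, hf⟩ := hBV
  have hx (i : ι) : ∃ x : Γ, ∀ p : B × V, x * f p * x⁻¹ = f (p.1, ρ (FreeGroup.of i) p.2) := by
    obtain ⟨e, he⟩ := hΓ.exists_conj_eq hfg f
      (f.comp ((MulEquiv.refl B).prodCongr (ρ (FreeGroup.of i))).toMonoidHom) hf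
      (hf.comp (MulEquiv.injective _))
    exact ⟨e⁻¹, fun p => by rw [inv_inv]; exact he p⟩
  choose x hx using hx
  have hconj (w : FreeGroup ι) :
      ∀ p : B × V, FreeGroup.lift x w * f p * (FreeGroup.lift x w)⁻¹ = f (p.1, ρ w p.2) := by
    induction w using FreeGroup.induction_on with
    | C1 => simp
    | of i => simpa using hx i
    | inv_of i _ =>
      intro p
      have h := hx i (p.1, (ρ (FreeGroup.of i))⁻¹ p.2)
      rw [MulAut.apply_inv_self] at h
      rw [map_inv, map_inv, FreeGroup.lift_apply_of, ← Prod.mk.eta (p := p), ← h]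
      group
    | mul v w hv hw =>
      intro p
      have h := hv (p.1, ρ w p.2)
      rw [← hw p] at h
      rw [map_mul, map_mul, MulAut.mul_apply, ← h]
      group
  have hcomm (b : B) (w : FreeGroup ι) : Commute (f (b, 1)) (FreeGroup.lift x w) := by
    have h := hconj w (b, 1)
    simp only [map_one] at h
    exact (mul_inv_eq_iff_eq_mul.1 h).symm
  -- If `f (b, 1)` times the image of `w` is trivial, that image lies in `f (B × 1)`, so it
  -- centralises `f (1 × V)`; faithfulness of `ρ` then gives `w = 1`.
  refine ⟨(f.comp (MonoidHom.inl B V)).noncommCoprod (FreeGroup.lift x) hcomm, ?_⟩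
  rw [injective_iff_map_eq_one]
  rintro ⟨b, w⟩ h
  change f (b, 1) * FreeGroup.lift x w = 1 at h
  have hw : w = 1 := by
    apply (injective_iff_map_eq_one ρ).1 hρ
    ext v
    have h1 := hconj w (1, v)
    rw [eq_inv_of_mul_eq_one_right h, ← map_inv, ← map_inv, ← map_mul, ← map_mul] at h1
    have h2 := hf h1
    simpa using (congrArg Prod.snd h2).symm
  subst hw
  rw [map_one, mul_one, map_eq_one_iff f hf] at h
  simpa using h

/-- The `k`-th power of the transvection `v ↦ v + N ω(u, v) u` of `ℤ²`, where `u = (1, c)` and `ω`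
is the standard symplectic form. -/
def intTransvection (N c : ℤ) : Multiplicative ℤ →* MulAut (Multiplicative (ℤ × ℤ)) where
  toFun k := AddEquiv.toMultiplicative
    { toFun := fun v => (v.1 + k.toAdd * N * (v.2 - c * v.1),
        v.2 + k.toAdd * N * (v.2 - c * v.1) * c)
      invFun := fun v => (v.1 - k.toAdd * N * (v.2 - c * v.1),
        v.2 - k.toAdd * N * (v.2 - c * v.1) * c)
      left_inv := fun v => by ext <;> simp <;> ring
      right_inv := fun v => by ext <;> simp <;> ring
      map_add' := fun v w => by ext <;> simp <;> ring }
  map_one' := by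
    ext v <;> simp
  map_mul' k l := by
    ext v
    · simp [MulAut.mul_apply]; ring
    · simp [MulAut.mul_apply]; ring

/-- The ping-pong estimate. The linear relation bounds `|z|` by `(2m - 2)|x|`, while the
transvection shifts `z` by at least `2m|x|`. -/
theorem abs_lt_abs_add_transvection {m N i j l k x y z : ℤ} (hi : 0 ≤ i) (him : i < m)
    (hj : 0 ≤ j) (hjm : j < m) (hl : 0 ≤ l) (hlm : l < m) (hN : 2 * m ≤ N) (hij : i ≠ j)
    (hil : i ≠ l) (hk : k ≠ 0) (hxy : |y| < |x|)
    (hz : (i - j) * z = (l - j) * x + (i - l) * y) :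
    |x| < |z + k * N * x * (i - l)| := by
  have hx : 0 < |x| := (abs_nonneg y).trans_lt hxy
  have h1 : |z| ≤ (2 * m - 2) * |x| := by
    have h2 : |(i - j) * z| ≤ (m - 1) * |x| + (m - 1) * |x| := by
      rw [hz]
      refine (abs_add_le _ _).trans ?_
      rw [abs_mul, abs_mul]
      have : |l - j| ≤ m - 1 := abs_le.2 ⟨by omega, by omega⟩
      have : |i - l| ≤ m - 1 := abs_le.2 ⟨by omega, by omega⟩
      gcongr
      · omega
    have h3 : 1 * |z| ≤ |i - j| * |z| := by
      gcongr
      exact Int.one_le_abs (sub_ne_zero.2 hij)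
    rw [abs_mul] at h2
    linarith
  have h2 : 2 * m * |x| ≤ |k * N * x * (i - l)| := by
    have hk1 := Int.one_le_abs hk
    have hil1 := Int.one_le_abs (sub_ne_zero.2 hil)
    rw [abs_mul, abs_mul, abs_mul]
    have hN' : 2 * m ≤ |N| := hN.trans (le_abs_self N)
    calc 2 * m * |x| = 1 * (2 * m) * |x| * 1 := by ring
      _ ≤ |k| * |N| * |x| * |i - l| := by
        gcongr
        omega
  have h3 := abs_sub_abs_le_abs_sub (k * N * x * (i - l)) (-z)
  rw [abs_neg, sub_neg_eq_add, add_comm] at h3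
  linarith

/-- Free groups of finite rank act faithfully on `ℤ²`. -/
theorem exists_injective_freeGroup_mulAut_int_prod (n : ℕ) :
    ∃ ρ : FreeGroup (Fin n) →* MulAut (Multiplicative (ℤ × ℤ)), Function.Injective ρ := by
  -- Ping-pong needs at least two players.
  suffices h : ∃ ρ : FreeGroup (Fin (n + 2)) →* MulAut (Multiplicative (ℤ × ℤ)),
      Function.Injective ρ by
    obtain ⟨ρ, hρ⟩ := h
    exact ⟨ρ.comp (FreeGroup.map (Fin.castAdd 2)),
      hρ.comp (FreeGroup.map_injective (Fin.castAdd_injective n 2))⟩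
  let m : ℤ := n + 2
  let ω (i : Fin (n + 2)) (v : Multiplicative (ℤ × ℤ)) : ℤ := v.toAdd.2 - i * v.toAdd.1
  -- Vectors strictly closest in direction to `(1, i)`, as measured by `ω`. The transvection along
  -- `(1, i)` fixes `ω i` and enlarges all the other forms.
  let X (i : Fin (n + 2)) : Set (Multiplicative (ℤ × ℤ)) := {v | ∀ j, j ≠ i → |ω i v| < |ω j v|}
  let f (i : Fin (n + 2)) : FreeGroup Unit →* MulAut (Multiplicative (ℤ × ℤ)) :=
    FreeGroup.lift fun _ => intTransvection (2 * m) i (Multiplicative.ofAdd 1)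
  refine ⟨(Monoid.CoprodI.lift f).comp (freeGroupEquivCoprodI (ι := Fin (n + 2))).toMonoidHom, ?_⟩
  rw [MonoidHom.coe_comp]
  refine Function.Injective.comp ?_ (MulEquiv.injective freeGroupEquivCoprodI)
  refine Monoid.CoprodI.lift_injective_of_ping_pong f (Or.inr ⟨0, ?_⟩) X ?_ ?_ ?_
  · exact (Cardinal.natCast_lt_aleph0 (n := 3)).le.trans (Cardinal.aleph0_le_mk _)
  · intro i
    refine ⟨Multiplicative.ofAdd (1, (i : ℤ)), fun j hj => ?_⟩
    have : (i : ℤ) - j ≠ 0 := by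
      have := Fin.val_ne_of_ne hj
      omega
    simpa [ω] using this
  · intro i j hij
    refine Set.disjoint_left.2 fun v hi hj => ?_
    exact lt_asymm (hi j hij.symm) (hj i hij)
  · intro i j hij
    refine FreeGroup.freeGroupUnitEquivInt.forall_congr_left.mpr fun k hk => ?_
    have hk0 : k ≠ 0 := by
      rintro rfl
      exact hk (by simp [FreeGroup.freeGroupUnitEquivInt])
    have hfk : f i (FreeGroup.freeGroupUnitEquivInt.symm k) =
        intTransvection (2 * m) i (Multiplicative.ofAdd k) := by
      change f i (FreeGroup.of () ^ k) = _
      rw [map_zpow, FreeGroup.lift_apply_of, ← map_zpow, ← ofAdd_zsmul, smul_eq_mul, mul_one]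
    rw [hfk]
    rintro _ ⟨v, hv, rfl⟩ l hl
    have hω (l : Fin (n + 2)) :
        ω l (intTransvection (2 * m) i (Multiplicative.ofAdd k) • v) =
          ω l v + k * (2 * m) * ω i v * (i - l) := by
      simp [ω, intTransvection]
      ring
    have h := abs_lt_abs_add_transvection (m := m) (N := 2 * m) (i := i) (j := j) (l := l) (k := k)
      (x := ω i v) (y := ω j v) (z := ω l v) (by omega) (by omega) (by omega) (by omega) (by omega)
      (by omega) le_rfl (by have := Fin.val_ne_of_ne hij; omega)
      (by have := Fin.val_ne_of_ne hl; omega) hk0 (hv i hij) (by simp only [ω]; ring)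
    simp only [hω, sub_self, mul_zero, add_zero]
    exact h

theorem IsInnerUltrahomogeneous.inAge_prod_freeGroup {Γ : Type u} [Group Γ]
    (hΓ : IsInnerUltrahomogeneous Γ) (hAge : AgeClosedUnderProdInt Γ) {B : Type u} [Group B]
    (hB : InAge Γ B) (n : ℕ) : InAge Γ (B × FreeGroup (Fin n)) := by
  obtain ⟨ρ, hρ⟩ := exists_injective_freeGroup_mulAut_int_prod n
  have hBZ := hAge _ (hAge _ hB)
  have := hB.1
  let e : B × Multiplicative (ℤ × ℤ) ≃* (B × Multiplicative ℤ) × Multiplicative ℤ :=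
    ((MulEquiv.refl B).prodCongr (MulEquiv.prodMultiplicative ℤ ℤ)).trans MulEquiv.prodAssoc.symm
  have hBV : InAge Γ (B × Multiplicative (ℤ × ℤ)) :=
    hBZ.of_injective inferInstance e.toMonoidHom e.injective
  obtain ⟨f, hf⟩ := hΓ.exists_embedding_prod_freeGroup hBV ρ hρ
  exact ⟨inferInstance, f, hf⟩

/-! ### Amalgamation of inner systems -/

/-- The shear `(a, l) ↦ (a φ(l), l)` of a direct product, where `φ : L → B` is a homomorphism whose
image centralises the subgroup `A` of `B`. -/
theorem exists_shear {B L : Type*} [Group B] [Group L] (A : Subgroup B) (φ : L →* B)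
    (hφ : ∀ (a : A) (l : L), Commute (a : B) (φ l)) :
    ∃ s : A × L →* B × L, Function.Injective s ∧ ∀ a l, s (a, l) = (a * φ l, l) := by
  let s : A × L →* B × L := (A.subtype.noncommCoprod φ hφ).prod (MonoidHom.snd A L)
  have hs (a : A) (l : L) : s (a, l) = (a * φ l, l) := rfl
  refine ⟨s, ?_, hs⟩
  rintro ⟨a, l⟩ ⟨a', l'⟩ h
  rw [hs, hs, Prod.mk.injEq] at h
  obtain ⟨h, rfl⟩ := h
  rw [mul_left_inj, Subtype.coe_inj] at h
  rw [h]

/-- Amalgamation of two extensions of a finitely generated group with inner automorphisms, where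
the differences of the inner automorphisms from those of the base have a common cover `L`. -/
theorem IsInnerUltrahomogeneous.exists_amalgam_of_cover {Γ : Type u} [Group Γ]
    (hΓ : IsInnerUltrahomogeneous Γ) {n : ℕ} {A B C : Subgroup Γ} (hA : A.FG) (hAB : A ≤ B)
    (hAC : A ≤ C) {g h k : Fin n → Γ} (hg : ∀ i, g i ∈ A) (hh : ∀ i, h i ∈ B) (hk : ∀ i, k i ∈ C)
    {L : Type v} [Group L] (l : Fin n → L) (φ : L →* B) (ψ : L →* C)
    (hφ : ∀ i, (φ (l i) : Γ) = (g i)⁻¹ * h i) (hψ : ∀ i, (ψ (l i) : Γ) = (g i)⁻¹ * k i)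
    (hφA : ∀ a ∈ A, ∀ x, Commute a (φ x : Γ)) (hψA : ∀ a ∈ A, ∀ x, Commute a (ψ x : Γ))
    (hBL : InAge Γ (B × L)) (hCL : InAge Γ (C × L)) :
    ∃ (c : Γ) (d : Fin n → Γ), (∀ a ∈ A, Commute a c) ∧
      (∀ i, ∀ b ∈ C, (d i)⁻¹ * b * d i = (k i)⁻¹ * b * k i) ∧
      ∀ i, ∀ b ∈ B, (d i)⁻¹ * (c⁻¹ * b * c) * d i = c⁻¹ * ((h i)⁻¹ * b * h i) * c := by
  obtain ⟨s, hs, hs'⟩ := exists_shear (A.subgroupOf B) φ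
    fun a x => Subtype.ext (hφA a a.2 x)
  obtain ⟨t, ht, ht'⟩ := exists_shear (A.subgroupOf C) ψ
    fun a x => Subtype.ext (hψA a a.2 x)
  obtain ⟨hBfg, β, hβ⟩ := hBL
  obtain ⟨hCfg, γ₀, hγ₀⟩ := hCL
  have hB : Group.FG B := Group.fg_of_surjective (f := MonoidHom.fst B L) Prod.fst_surjective
  have hC : Group.FG C := Group.fg_of_surjective (f := MonoidHom.fst C L) Prod.fst_surjective
  have hL : Group.FG L := Group.fg_of_surjective (f := MonoidHom.snd B L) Prod.snd_surjective
  have hA' : Group.FG A := (Group.fg_iff_subgroup_fg A).2 hA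
  obtain ⟨e₀, he₀⟩ := hΓ.exists_conj_eq hC (γ₀.comp (MonoidHom.inl C L)) C.subtype
    (hγ₀.comp (fun x y h => (Prod.mk.inj h).1)) C.subtype_injective
  let γ : C × L →* Γ := (MulAut.conj e₀⁻¹).toMonoidHom.comp γ₀
  have hγ : Function.Injective γ := (MulAut.conj e₀⁻¹).injective.comp hγ₀
  have hγC (x : C) : γ (x, 1) = x := by
    have := he₀ x
    simpa [γ] using this
  let sA : A × L →* B × L :=
    s.comp ((Subgroup.subgroupOfEquivOfLe hAB).symm.prodCongr (MulEquiv.refl L)).toMonoidHom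
  let tA : A × L →* C × L :=
    t.comp ((Subgroup.subgroupOfEquivOfLe hAC).symm.prodCongr (MulEquiv.refl L)).toMonoidHom
  have hsA (a : A) (x : L) : sA (a, x) = (⟨a, hAB a.2⟩ * φ x, x) := hs' _ _
  have htA (a : A) (x : L) : tA (a, x) = (⟨a, hAC a.2⟩ * ψ x, x) := ht' _ _
  obtain ⟨e, he⟩ := hΓ.exists_conj_eq inferInstance (β.comp sA) (γ.comp tA)
    (hβ.comp (hs.comp (MulEquiv.injective _))) (hγ.comp (ht.comp (MulEquiv.injective _)))
  let β' : B × L →* Γ := (MulAut.conj e⁻¹).toMonoidHom.comp β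
  have hβ' : Function.Injective β' := (MulAut.conj e⁻¹).injective.comp hβ
  have hβγ (x : A × L) : β' (sA x) = γ (tA x) := by
    have := he x
    simpa [β'] using this
  obtain ⟨c, hc⟩ := hΓ.exists_conj_eq hB B.subtype (β'.comp (MonoidHom.inl B L))
    B.subtype_injective (hβ'.comp (fun x y h => (Prod.mk.inj h).1))
  have hc' (b : Γ) (hb : b ∈ B) : c⁻¹ * b * c = β' (⟨b, hb⟩, 1) := hc ⟨b, hb⟩
  -- The shears were built for this: one element of `A × L` becomes `h i` on one side and `k i` on
  -- the other, up to `l i`, which commutes with `B` and `C`.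
  have hdB (i : Fin n) : sA (⟨g i, hg i⟩, l i) = (⟨h i, hh i⟩, l i) := by
    rw [hsA, Prod.mk.injEq]
    exact ⟨Subtype.ext (by simp [hφ]), rfl⟩
  have hdC (i : Fin n) : tA (⟨g i, hg i⟩, l i) = (⟨k i, hk i⟩, l i) := by
    rw [htA, Prod.mk.injEq]
    exact ⟨Subtype.ext (by simp [hψ]), rfl⟩
  refine ⟨c, fun i => γ (tA (⟨g i, hg i⟩, l i)), fun a ha => ?_, fun i b hb => ?_,
    fun i b hb => ?_⟩
  · have h1 := hβγ (⟨a, ha⟩, 1)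
    rw [hsA, htA, map_one, map_one, mul_one, mul_one, hγC, ← hc' a (hAB ha)] at h1
    rw [mul_assoc, inv_mul_eq_iff_eq_mul] at h1
    exact h1
  · beta_reduce
    have hbγ : γ (⟨b, hb⟩, 1) = b := hγC _
    calc _ = (γ (⟨k i, hk i⟩, l i))⁻¹ * γ (⟨b, hb⟩, 1) * γ (⟨k i, hk i⟩, l i) := by rw [hdC, hbγ]
      _ = γ (⟨k i, hk i⟩⁻¹ * ⟨b, hb⟩ * ⟨k i, hk i⟩, 1) := by
        rw [← map_inv, ← map_mul, ← map_mul]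
        congr 1
        ext <;> simp
      _ = _ := hγC _
  · have hb' : (h i)⁻¹ * b * h i ∈ B := mul_mem (mul_mem (inv_mem (hh i)) hb) (hh i)
    beta_reduce
    rw [← hβγ, hdB, hc' b hb, hc' _ hb', ← map_inv, ← map_mul, ← map_mul]
    congr 1
    ext <;> simp

theorem commute_of_mem_closure_range {G : Type*} [Group G] {ι : Type*} {z : ι → G} {a : G}
    (h : ∀ i, Commute a (z i)) {x : G} (hx : x ∈ Subgroup.closure (Set.range z)) : Commute a x := by
  have : Subgroup.closure (Set.range z) ≤ Subgroup.centralizer {a} := by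
    rw [Subgroup.closure_le]
    rintro _ ⟨i, rfl⟩
    exact Subgroup.mem_centralizer_singleton_iff.2 (h i).eq.symm
  exact (Subgroup.mem_centralizer_singleton_iff.1 (this hx)).symm

theorem commute_inv_mul_of_conj_eq {G : Type*} [Group G] {a g h : G}
    (H : h⁻¹ * a * h = g⁻¹ * a * g) : Commute (g⁻¹ * a * g) (g⁻¹ * h) := by
  rw [Commute, SemiconjBy]
  nth_rewrite 2 [← H]
  group

theorem IsInnerUltrahomogeneous.exists_amalgam {Γ : Type u} [Group Γ]
    (hΓ : IsInnerUltrahomogeneous Γ) (hAge : AgeClosedUnderProd Γ ∨ AgeClosedUnderProdInt Γ)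
    {n : ℕ} {A B C : Subgroup Γ} (hA : A.FG) (hB : B.FG) (hC : C.FG) (hAB : A ≤ B)
    (hAC : A ≤ C) {g h k : Fin n → Γ} (hg : ∀ i, g i ∈ A) (hh : ∀ i, h i ∈ B) (hk : ∀ i, k i ∈ C)
    (hgh : ∀ i, ∀ a ∈ A, (h i)⁻¹ * a * h i = (g i)⁻¹ * a * g i)
    (hgk : ∀ i, ∀ a ∈ A, (k i)⁻¹ * a * k i = (g i)⁻¹ * a * g i) :
    ∃ (c : Γ) (d : Fin n → Γ), (∀ a ∈ A, Commute a c) ∧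
      (∀ i, ∀ b ∈ C, (d i)⁻¹ * b * d i = (k i)⁻¹ * b * k i) ∧
      ∀ i, ∀ b ∈ B, (d i)⁻¹ * (c⁻¹ * b * c) * d i = c⁻¹ * ((h i)⁻¹ * b * h i) * c := by
  have hcomm {h : Fin n → Γ} (hgh : ∀ i, ∀ a ∈ A, (h i)⁻¹ * a * h i = (g i)⁻¹ * a * g i)
      (a : Γ) (ha : a ∈ A) (i : Fin n) : Commute a ((g i)⁻¹ * h i) := by
    have := commute_inv_mul_of_conj_eq
      (hgh i (g i * a * (g i)⁻¹) (mul_mem (mul_mem (hg i) ha) (inv_mem (hg i))))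
    simpa [mul_assoc] using this
  let z (i : Fin n) : B := ⟨(g i)⁻¹ * h i, mul_mem (inv_mem (hAB (hg i))) (hh i)⟩
  let w (i : Fin n) : C := ⟨(g i)⁻¹ * k i, mul_mem (inv_mem (hAC (hg i))) (hk i)⟩
  have hz (a : B) (ha : (a : Γ) ∈ A) (i : Fin n) : Commute a (z i) :=
    Subtype.ext (hcomm hgh a ha i)
  have hw (a : C) (ha : (a : Γ) ∈ A) (i : Fin n) : Commute a (w i) :=
    Subtype.ext (hcomm hgk a ha i)
  have hBage : InAge Γ B := .of_subgroup hB
  have hCage : InAge Γ C := .of_subgroup hC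
  have hz' (a : Γ) (ha : a ∈ A) (x : B) (hx : x ∈ Subgroup.closure (Set.range z)) :
      Commute a (x : Γ) :=
    congrArg Subtype.val (commute_of_mem_closure_range (hz ⟨a, hAB ha⟩ ha) hx).eq
  have hw' (a : Γ) (ha : a ∈ A) (x : C) (hx : x ∈ Subgroup.closure (Set.range w)) :
      Commute a (x : Γ) :=
    congrArg Subtype.val (commute_of_mem_closure_range (hw ⟨a, hAC ha⟩ ha) hx).eq
  rcases hAge with hAge | hAge
  -- The smallest common cover of the two tuples of differences.
  · let L : Subgroup (B × C) := Subgroup.closure (Set.range fun i => (z i, w i))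
    have hLfg : Group.FG L :=
      (Group.fg_iff_subgroup_fg L).2 ((Subgroup.fg_iff L).2 ⟨_, rfl, Set.finite_range _⟩)
    have hL : InAge Γ L := (hAge _ _ hBage hCage).of_injective hLfg L.subtype L.subtype_injective
    refine hΓ.exists_amalgam_of_cover hA hAB hAC hg hh hk
      (fun i => (⟨(z i, w i), Subgroup.subset_closure ⟨i, rfl⟩⟩ : L))
      ((MonoidHom.fst B C).comp L.subtype) ((MonoidHom.snd B C).comp L.subtype)
      (fun i => rfl) (fun i => rfl) (fun a ha x => hz' a ha _ ?_) (fun a ha x => hw' a ha _ ?_)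
      (hAge _ _ hBage hL) (hAge _ _ hCage hL)
    · have h1 := Subgroup.mem_map_of_mem (MonoidHom.fst B C) x.2
      rw [MonoidHom.map_closure, ← Set.range_comp] at h1
      exact h1
    · have h1 := Subgroup.mem_map_of_mem (MonoidHom.snd B C) x.2
      rw [MonoidHom.map_closure, ← Set.range_comp] at h1
      exact h1
  · refine hΓ.exists_amalgam_of_cover hA hAB hAC hg hh hk FreeGroup.of (FreeGroup.lift z)
      (FreeGroup.lift w) (fun i => by simp [z]) (fun i => by simp [w])
      (fun a ha x => hz' a ha _ ?_) (fun a ha x => hw' a ha _ ?_)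
      (hΓ.inAge_prod_freeGroup hAge hBage n) (hΓ.inAge_prod_freeGroup hAge hCage n)
    · rw [← FreeGroup.range_lift_eq_closure]
      exact ⟨x, rfl⟩
    · rw [← FreeGroup.range_lift_eq_closure]
      exact ⟨x, rfl⟩

/-! ### The Polish topology of the automorphism group -/

section Topology

variable {Γ : Type u} [Group Γ]

theorem isOpen_setOf_mulAut_apply_eq (a b : Γ) : IsOpen {σ : MulAut Γ | σ a = b} := by
  rw [isOpen_iff_mem_nhds]
  intro σ hσ
  refine (autTopology_nhds_hasBasis Γ σ).mem_iff.2 ⟨{a}, trivial, fun τ hτ => ?_⟩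
  exact (hτ a (Finset.mem_singleton_self a)).trans hσ

theorem isClosed_setOf_mulAut_apply_eq (a b : Γ) : IsClosed {σ : MulAut Γ | σ a = b} := by
  have : {σ : MulAut Γ | σ a = b}ᶜ = ⋃ c ∈ {c | c ≠ b}, {σ : MulAut Γ | σ a = c} := by
    ext σ
    simp
  rw [← isOpen_compl_iff, this]
  exact isOpen_biUnion fun c _ => isOpen_setOf_mulAut_apply_eq a c

theorem exists_finset_of_mem_isOpen {n : ℕ} {V : Set (Fin n → MulAut Γ)} (hV : IsOpen V)
    {τ : Fin n → MulAut Γ} (hτ : τ ∈ V) :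
    ∃ F : Finset Γ, ∀ σ : Fin n → MulAut Γ, (∀ i, ∀ a ∈ F, σ i a = τ i a) → σ ∈ V := by
  classical
  have h := hV.mem_nhds hτ
  rw [nhds_pi, Filter.mem_pi] at h
  obtain ⟨I, -, t, ht, hsub⟩ := h
  have ht' (i : Fin n) := (autTopology_nhds_hasBasis Γ (τ i)).mem_iff.1 (ht i)
  choose F _ hF using ht'
  refine ⟨Finset.univ.biUnion F, fun σ hσ => hsub fun i _ => hF i fun a ha => hσ i a ?_⟩
  exact Finset.mem_biUnion.2 ⟨i, Finset.mem_univ i, ha⟩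

/-- The automorphism group of a countable group is a Polish space. -/
theorem polishSpace_mulAut [Countable Γ] : PolishSpace (MulAut Γ) := by
  let _ : TopologicalSpace Γ := ⊥
  have : DiscreteTopology Γ := ⟨rfl⟩
  -- Recording the inverse turns bijectivity into equations, so the image is closed.
  let f : MulAut Γ → (Γ → Γ) × (Γ → Γ) := fun σ => (σ, ⇑σ⁻¹)
  have heval (a : Γ) : Continuous fun σ : MulAut Γ => σ a :=
    continuous_discrete_rng.2 fun b => isOpen_setOf_mulAut_apply_eq a b
  have hf : Continuous f :=
    (continuous_pi heval).prodMk ((continuous_pi heval).comp continuous_inv)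
  have hind : IsInducing f := by
    refine ⟨le_antisymm hf.le_induced ?_⟩
    refine le_generateFrom ?_
    rintro _ ⟨τ, S, rfl⟩
    refine ⟨⋂ a ∈ S, {p | p.1 a = τ a}, ?_, ?_⟩
    · refine isOpen_biInter_finset fun a _ => ?_
      have h : Continuous fun p : (Γ → Γ) × (Γ → Γ) => p.1 a :=
        (continuous_apply a).comp continuous_fst
      exact h.isOpen_preimage _ (isOpen_discrete {τ a})
    · ext σ
      simp [f]
  have hinj : Function.Injective f := fun σ τ h => DFunLike.coe_injective (Prod.mk.inj h).1
  have hrange : Set.range f = {p | (∀ a, p.1 (p.2 a) = a ∧ p.2 (p.1 a) = a) ∧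
      ∀ a b, p.1 (a * b) = p.1 a * p.1 b} := by
    ext p
    constructor
    · rintro ⟨σ, rfl⟩
      exact ⟨fun a => ⟨MulAut.apply_inv_self _ _ _, MulAut.inv_apply_self _ _ _⟩, map_mul σ⟩
    · rintro ⟨h1, h2⟩
      exact ⟨⟨⟨p.1, p.2, fun a => (h1 a).2, fun a => (h1 a).1⟩, h2⟩, rfl⟩
  have hcl (a : Γ) : IsClosed {p : (Γ → Γ) × (Γ → Γ) | p.1 (p.2 a) = a ∧ p.2 (p.1 a) = a} := by
    have h : Continuous fun q : (Γ → Γ) × Γ => q.1 q.2 :=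
      continuous_prod_of_discrete_right.2 fun b => continuous_apply b
    have h1 : Continuous fun p : (Γ → Γ) × (Γ → Γ) => p.1 (p.2 a) :=
      h.comp (continuous_fst.prodMk ((continuous_apply a).comp continuous_snd))
    have h2 : Continuous fun p : (Γ → Γ) × (Γ → Γ) => p.2 (p.1 a) :=
      h.comp (continuous_snd.prodMk ((continuous_apply a).comp continuous_fst))
    exact (isClosed_eq h1 continuous_const).inter (isClosed_eq h2 continuous_const)
  have hclosed : IsClosed (Set.range f) := by
    rw [hrange, Set.ofPred_and]
    refine IsClosed.inter ?_ ?_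
    · rw [Set.ofPred_forall]
      exact isClosed_iInter hcl
    · simp only [Set.ofPred_forall]
      refine isClosed_iInter fun a => isClosed_iInter fun b => isClosed_eq ?_ ?_ <;> fun_prop
  have : PolishSpace ((Γ → Γ) × (Γ → Γ)) := {}
  exact Topology.IsClosedEmbedding.polishSpace ⟨⟨hind, hinj⟩, hclosed⟩

end Topology

/-! ### Two comeagre properties of tuples -/

/-- `σ i` is conjugation by `g i` on `S`. -/
def ConjOn {Γ : Type u} [Group Γ] {n : ℕ} (σ : Fin n → MulAut Γ) (S : Finset Γ)
    (g : Fin n → Γ) : Prop :=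
  ∀ i, ∀ a ∈ S, σ i a = (g i)⁻¹ * a * g i

/-- Every finite set is contained in one on which the tuple `σ` is given by conjugation by elements
of that set. -/
def IsLocallyInner {Γ : Type u} [Group Γ] {n : ℕ} (σ : Fin n → MulAut Γ) : Prop :=
  ∀ R : Finset Γ, ∃ (S : Finset Γ) (g : Fin n → Γ), R ⊆ S ∧ (∀ i, g i ∈ S) ∧ ConjOn σ S g

/-- If `σ i` acts on `S` as conjugation by `g i`, then it acts on some conjugate of `T` over `S`
as conjugation by `h i` acts on `T`. -/
def Realizes {Γ : Type u} [Group Γ] {n : ℕ} (σ : Fin n → MulAut Γ) (S T : Finset Γ)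
    (g h : Fin n → Γ) : Prop :=
  ConjOn σ S g → ∃ c, (∀ a ∈ S, Commute a c) ∧
    ∀ i, ∀ b ∈ T, σ i (c⁻¹ * b * c) = c⁻¹ * ((h i)⁻¹ * b * h i) * c

/-- `σ` realizes all extensions `(T, h)` of all finite inner subsystems `(S, g)`. -/
def IsExtensive {Γ : Type u} [Group Γ] {n : ℕ} (σ : Fin n → MulAut Γ) : Prop :=
  ∀ (S T : Finset Γ) (g h : Fin n → Γ), S ⊆ T → (∀ i, g i ∈ S) →
    (∀ i, ∀ a ∈ S, (h i)⁻¹ * a * h i = (g i)⁻¹ * a * g i) → Realizes σ S T g h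

section Generic

variable {Γ : Type u} [Group Γ] {n : ℕ}

theorem isClopen_setOf_conjOn (S : Finset Γ) (g : Fin n → Γ) :
    IsClopen {σ : Fin n → MulAut Γ | ConjOn σ S g} := by
  have : {σ : Fin n → MulAut Γ | ConjOn σ S g} =
      ⋂ i, ⋂ a ∈ S, (fun σ => σ i) ⁻¹' {σ : MulAut Γ | σ a = (g i)⁻¹ * a * g i} := by
    ext σ
    simp [ConjOn]
  rw [this]
  refine isClopen_iInter_of_finite fun i => S.finite_toSet.isClopen_biInter fun a _ => ?_
  exact ⟨(isClosed_setOf_mulAut_apply_eq _ _).preimage (continuous_apply i),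
    (isOpen_setOf_mulAut_apply_eq _ _).preimage (continuous_apply i)⟩

theorem isOpen_setOf_realizes (S T : Finset Γ) (g h : Fin n → Γ) :
    IsOpen {σ : Fin n → MulAut Γ | Realizes σ S T g h} := by
  have : {σ : Fin n → MulAut Γ | Realizes σ S T g h} =
      {σ : Fin n → MulAut Γ | ConjOn σ S g}ᶜ ∪ ⋃ c ∈ {c | ∀ a ∈ S, Commute a c}, ⋂ i, ⋂ b ∈ T,
        (fun σ => σ i) ⁻¹' {σ : MulAut Γ | σ (c⁻¹ * b * c) = c⁻¹ * ((h i)⁻¹ * b * h i) * c} := by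
    ext σ
    simp [Realizes, imp_iff_not_or]
  rw [this]
  refine (isClopen_setOf_conjOn S g).compl.isOpen.union (isOpen_biUnion fun c _ => ?_)
  refine isOpen_iInter_of_finite fun i => isOpen_biInter_finset fun b _ => ?_
  exact (isOpen_setOf_mulAut_apply_eq _ _).preimage (continuous_apply i)

/-- Inner automorphisms are dense in the automorphism group of an inner ultrahomogeneous group. -/
theorem IsInnerUltrahomogeneous.exists_conjOn (hΓ : IsInnerUltrahomogeneous Γ)
    (σ : Fin n → MulAut Γ) (S : Finset Γ) : ∃ g, ConjOn σ S g := by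
  have h (i : Fin n) : ∃ g : Γ, ∀ a ∈ S, σ i a = g⁻¹ * a * g := by
    let A := Subgroup.closure (S : Set Γ)
    obtain ⟨g, hg⟩ := hΓ.exists_conj_eq (A := A) ((Group.fg_iff_subgroup_fg A).2 ⟨S, rfl⟩)
      A.subtype ((σ i).toMonoidHom.comp A.subtype) A.subtype_injective
      ((σ i).injective.comp A.subtype_injective)
    exact ⟨g, fun a ha => (hg ⟨a, Subgroup.subset_closure ha⟩).symm⟩
  choose g hg using h
  exact ⟨g, hg⟩

/-- The tuple of inner automorphisms `a ↦ g⁻¹ a g`. -/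
def innerTuple (g : Fin n → Γ) : Fin n → MulAut Γ := fun i => MulAut.conj (g i)⁻¹

theorem innerTuple_apply (g : Fin n → Γ) (i : Fin n) (a : Γ) :
    innerTuple g i a = (g i)⁻¹ * a * g i := by
  simp [innerTuple]

/-- Every nonempty open set contains a tuple of inner automorphisms, and for such a tuple it
suffices to add the conjugating elements to `R`. -/
theorem IsInnerUltrahomogeneous.isLocallyInner_mem_residual [Countable Γ]
    (hΓ : IsInnerUltrahomogeneous Γ) :
    {σ : Fin n → MulAut Γ | IsLocallyInner σ} ∈ residual (Fin n → MulAut Γ) := by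
  classical
  simp only [IsLocallyInner, Set.ofPred_forall]
  refine countable_iInter_mem.2 fun R => residual_of_dense_open ?_ ?_
  · have : {σ : Fin n → MulAut Γ | ∃ (S : Finset Γ) (g : Fin n → Γ),
        R ⊆ S ∧ (∀ i, g i ∈ S) ∧ ConjOn σ S g} =
        ⋃ p ∈ {p : Finset Γ × (Fin n → Γ) | R ⊆ p.1 ∧ ∀ i, p.2 i ∈ p.1},
          {σ : Fin n → MulAut Γ | ConjOn σ p.1 p.2} := by
      ext σ
      simp [and_assoc]
    rw [this]
    exact isOpen_biUnion fun p _ => (isClopen_setOf_conjOn p.1 p.2).isOpen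
  · rw [dense_iff_inter_open]
    rintro V hV ⟨τ, hτ⟩
    obtain ⟨F, hF⟩ := exists_finset_of_mem_isOpen hV hτ
    obtain ⟨g, hg⟩ := hΓ.exists_conjOn τ F
    refine ⟨innerTuple g, hF _ fun i a ha => ?_, R ∪ Finset.univ.image g, g,
      Finset.subset_union_left, fun i => ?_, fun i a _ => innerTuple_apply g i a⟩
    · rw [innerTuple_apply, hg i a ha]
    · exact Finset.mem_union_right _ (Finset.mem_image_of_mem g (Finset.mem_univ i))

/-- On `S` and the finite set defining a neighbourhood of `τ`, the tuple `τ` is conjugation by some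
`k`. Amalgamating `k` with `h` over `g` yields an inner tuple in the neighbourhood that realizes the
extension. -/
theorem IsInnerUltrahomogeneous.dense_setOf_realizes (hΓ : IsInnerUltrahomogeneous Γ)
    (hAge : AgeClosedUnderProd Γ ∨ AgeClosedUnderProdInt Γ) {S T : Finset Γ} {g h : Fin n → Γ}
    (hST : S ⊆ T) (hg : ∀ i, g i ∈ S)
    (hgh : ∀ i, ∀ a ∈ S, (h i)⁻¹ * a * h i = (g i)⁻¹ * a * g i) :
    Dense {σ : Fin n → MulAut Γ | Realizes σ S T g h} := by
  classical
  rw [dense_iff_inter_open]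
  rintro V hV ⟨τ, hτ⟩
  by_cases hτS : ConjOn τ S g
  swap
  · exact ⟨τ, hτ, fun h => absurd h hτS⟩
  obtain ⟨F, hF⟩ := exists_finset_of_mem_isOpen hV hτ
  obtain ⟨k, hk⟩ := hΓ.exists_conjOn τ (S ∪ F)
  have hext {p : Fin n → Γ} (hp : ∀ i, ∀ a ∈ S, (p i)⁻¹ * a * p i = (g i)⁻¹ * a * g i) (i : Fin n)
      (a : Γ) (ha : a ∈ Subgroup.closure (S : Set Γ)) :
      (p i)⁻¹ * a * p i = (g i)⁻¹ * a * g i := by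
    have h1 : Set.EqOn (MulAut.conj (p i)⁻¹).toMonoidHom (MulAut.conj (g i)⁻¹).toMonoidHom S :=
      fun a ha => by simpa using hp i a ha
    simpa using MonoidHom.eqOn_closure h1 ha
  have hgk (i : Fin n) (a : Γ) (ha : a ∈ S) : (k i)⁻¹ * a * k i = (g i)⁻¹ * a * g i := by
    rw [← hk i a (Finset.mem_union_left _ ha), hτS i a ha]
  obtain ⟨c, d, hc, hdk, hdh⟩ := hΓ.exists_amalgam hAge (n := n)
    (A := Subgroup.closure (S : Set Γ))
    (B := Subgroup.closure (T ∪ Finset.univ.image h : Finset Γ))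
    (C := Subgroup.closure (S ∪ F ∪ Finset.univ.image k : Finset Γ)) ⟨_, rfl⟩ ⟨_, rfl⟩ ⟨_, rfl⟩
    (Subgroup.closure_mono (Finset.coe_subset.2 (hST.trans Finset.subset_union_left)))
    (Subgroup.closure_mono
      (Finset.coe_subset.2 (Finset.subset_union_left.trans Finset.subset_union_left)))
    (g := g) (h := h) (k := k)
    (fun i => Subgroup.subset_closure (hg i))
    (fun i => Subgroup.subset_closure (Finset.mem_coe.2
      (Finset.mem_union_right _ (Finset.mem_image_of_mem h (Finset.mem_univ i)))))
    (fun i => Subgroup.subset_closure (Finset.mem_coe.2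
      (Finset.mem_union_right _ (Finset.mem_image_of_mem k (Finset.mem_univ i)))))
    (hext hgh) (hext hgk)
  refine ⟨innerTuple d, hF _ fun i a ha => ?_, fun _ => ⟨c, fun a ha => ?_, fun i b hb => ?_⟩⟩
  · have ha' := Finset.mem_union_right S ha
    rw [innerTuple_apply, hk i a ha', hdk i a]
    exact Subgroup.subset_closure (Finset.mem_coe.2 (Finset.mem_union_left _ ha'))
  · exact hc a (Subgroup.subset_closure ha)
  · rw [innerTuple_apply, hdh i b]
    exact Subgroup.subset_closure (Finset.mem_coe.2 (Finset.mem_union_left _ hb))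

theorem IsInnerUltrahomogeneous.isExtensive_mem_residual [Countable Γ]
    (hΓ : IsInnerUltrahomogeneous Γ)
    (hAge : AgeClosedUnderProd Γ ∨ AgeClosedUnderProdInt Γ) :
    {σ : Fin n → MulAut Γ | IsExtensive σ} ∈ residual (Fin n → MulAut Γ) := by
  simp only [IsExtensive, Set.ofPred_forall]
  refine countable_iInter_mem.2 fun S => countable_iInter_mem.2 fun T =>
    countable_iInter_mem.2 fun g => countable_iInter_mem.2 fun h =>
    countable_iInter_mem.2 fun hST => countable_iInter_mem.2 fun hg =>
    countable_iInter_mem.2 fun hgh => ?_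
  exact residual_of_dense_open (isOpen_setOf_realizes S T g h)
    (hΓ.dense_setOf_realizes hAge hST hg hgh)

end Generic

/-! ### Back-and-forth -/

/-- Conjugation by `c` is a partial isomorphism from `(Γ, σ)` to `(Γ, τ)` with domain `S`, where
`σ i` acts on `S` as conjugation by the element `g i` of `S`. -/
structure IsPartialConj {Γ : Type u} [Group Γ] {n : ℕ} (σ τ : Fin n → MulAut Γ) (S : Finset Γ)
    (g : Fin n → Γ) (c : Γ) : Prop where
  mem : ∀ i, g i ∈ S
  conjOn : ConjOn σ S g
  apply_conj : ∀ i, ∀ a ∈ S, τ i (c⁻¹ * a * c) = c⁻¹ * ((g i)⁻¹ * a * g i) * c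

section BackAndForth

variable {Γ : Type u} [Group Γ] {n : ℕ} {σ τ : Fin n → MulAut Γ}

open Classical in
theorem IsPartialConj.symm {S : Finset Γ} {g : Fin n → Γ} {c : Γ}
    (h : IsPartialConj σ τ S g c) :
    IsPartialConj τ σ (S.image fun a => c⁻¹ * a * c) (fun i => c⁻¹ * g i * c) c⁻¹ where
  mem i := Finset.mem_image_of_mem _ (h.mem i)
  conjOn i b hb := by
    obtain ⟨a, ha, rfl⟩ := Finset.mem_image.1 hb
    rw [h.apply_conj i a ha]
    group
  apply_conj i b hb := by
    obtain ⟨a, ha, rfl⟩ := Finset.mem_image.1 hb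
    have h1 : c⁻¹⁻¹ * (c⁻¹ * a * c) * c⁻¹ = a := by group
    rw [h1, h.conjOn i a ha]
    group

/-- Local innerness of `σ` supplies a larger piece containing `x`; its `c`-conjugate extends the
piece already matched, so extensiveness of `τ` realizes it after a correction `e` commuting with the
old image. -/
theorem IsPartialConj.exists_mem (hσ : IsLocallyInner σ) (hτ : IsExtensive τ) {S : Finset Γ}
    {g : Fin n → Γ} {c : Γ} (h : IsPartialConj σ τ S g c) (x : Γ) :
    ∃ (S' : Finset Γ) (g' : Fin n → Γ) (c' : Γ), IsPartialConj σ τ S' g' c' ∧ S ⊆ S' ∧ x ∈ S' ∧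
      ∀ a ∈ S, c'⁻¹ * a * c' = c⁻¹ * a * c := by
  classical
  obtain ⟨S', g', hS', hg', hσ'⟩ := hσ (insert x S)
  have hSS' : S ⊆ S' := (Finset.subset_insert x S).trans hS'
  obtain ⟨e, he, heτ⟩ := hτ (S.image fun a => c⁻¹ * a * c) (S'.image fun a => c⁻¹ * a * c)
    (fun i => c⁻¹ * g i * c) (fun i => c⁻¹ * g' i * c) (Finset.image_subset_image hSS')
    h.symm.mem (by
      intro i b hb
      obtain ⟨a, ha, rfl⟩ := Finset.mem_image.1 hb
      have h1 := (hσ' i a (hSS' ha)).symm.trans (h.conjOn i a ha)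
      calc _ = c⁻¹ * ((g' i)⁻¹ * a * g' i) * c := by group
        _ = _ := by rw [h1]; group) h.symm.conjOn
  refine ⟨S', g', c * e, ⟨hg', hσ', fun i a ha => ?_⟩, hSS', hS' (Finset.mem_insert_self x S),
    fun a ha => ?_⟩
  · have h1 := heτ i _ (Finset.mem_image_of_mem (fun a => c⁻¹ * a * c) ha)
    calc τ i ((c * e)⁻¹ * a * (c * e)) = τ i (e⁻¹ * (c⁻¹ * a * c) * e) := by congr 1; group
      _ = _ := by rw [h1]; group
  · have h1 := he _ (Finset.mem_image_of_mem (fun a => c⁻¹ * a * c) ha)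
    calc (c * e)⁻¹ * a * (c * e) = e⁻¹ * ((c⁻¹ * a * c) * e) := by group
      _ = c⁻¹ * a * c := by rw [h1.eq, inv_mul_cancel_left]

theorem IsPartialConj.exists_conj_mem (hσ : IsExtensive σ) (hτ : IsLocallyInner τ) {S : Finset Γ}
    {g : Fin n → Γ} {c : Γ} (h : IsPartialConj σ τ S g c) (y : Γ) :
    ∃ (S' : Finset Γ) (g' : Fin n → Γ) (c' : Γ), IsPartialConj σ τ S' g' c' ∧ S ⊆ S' ∧
      (∃ a ∈ S', c'⁻¹ * a * c' = y) ∧ ∀ a ∈ S, c'⁻¹ * a * c' = c⁻¹ * a * c := by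
  classical
  obtain ⟨S', g', c', h', hS', hy, hc'⟩ := h.symm.exists_mem hτ hσ y
  have key (a : Γ) (ha : a ∈ S) : c'⁻¹ * (c⁻¹ * a * c) * c' = a := by
    have h1 := hc' _ (Finset.mem_image_of_mem (fun a => c⁻¹ * a * c) ha)
    rw [h1]
    group
  refine ⟨_, _, _, h'.symm, fun a ha => ?_, ⟨_, Finset.mem_image_of_mem _ hy, by group⟩,
    fun a ha => ?_⟩
  · rw [← key a ha]
    exact Finset.mem_image_of_mem (fun a => c'⁻¹ * a * c')
      (hS' (Finset.mem_image_of_mem (fun a => c⁻¹ * a * c) ha))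
  · nth_rewrite 1 [← key a ha]
    group

/-- A chain of partial conjugations which exhausts the domain and the range defines an
automorphism. -/
theorem exists_mulAut_of_chain {S : ℕ → Finset Γ} {c : ℕ → Γ} (hS : Monotone S)
    (hc : ∀ m k, m ≤ k → ∀ a ∈ S m, (c k)⁻¹ * a * c k = (c m)⁻¹ * a * c m)
    (hdom : ∀ a, ∃ m, a ∈ S m) (hran : ∀ b, ∃ m, ∃ a ∈ S m, (c m)⁻¹ * a * c m = b) :
    ∃ κ : MulAut Γ, ∀ m, ∀ a ∈ S m, κ a = (c m)⁻¹ * a * c m := by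
  choose d hd using hdom
  let κ (a : Γ) : Γ := (c (d a))⁻¹ * a * c (d a)
  have hκ (m : ℕ) (a : Γ) (ha : a ∈ S m) : κ a = (c m)⁻¹ * a * c m := by
    rw [← hc _ _ (le_max_left m (d a)) a ha, hc _ _ (le_max_right m (d a)) a (hd a)]
  have hmul (a b : Γ) : κ (a * b) = κ a * κ b := by
    let m := max (max (d a) (d b)) (d (a * b))
    rw [hκ m a (hS (by simp [m]) (hd a)), hκ m b (hS (by simp [m]) (hd b)),
      hκ m (a * b) (hS (by simp [m]) (hd _))]
    group
  refine ⟨MulEquiv.ofBijective (MonoidHom.mk' κ hmul) ⟨?_, fun b => ?_⟩, hκ⟩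
  · rw [injective_iff_map_eq_one]
    intro a ha
    change (c (d a))⁻¹ * a * c (d a) = 1 at ha
    simpa [mul_eq_one_iff_eq_inv, inv_mul_eq_iff_eq_mul] using ha
  · obtain ⟨m, a, ha, rfl⟩ := hran b
    exact ⟨a, hκ m a ha⟩

theorem exists_conj_of_isExtensive [Countable Γ] (hσ : IsLocallyInner σ) (hσ' : IsExtensive σ)
    (hτ : IsLocallyInner τ) (hτ' : IsExtensive τ) :
    ∃ k : MulAut Γ, ∀ i, k⁻¹ * σ i * k = τ i := by
  obtain ⟨x, hx⟩ := exists_surjective_nat Γ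
  let State := {p : Finset Γ × (Fin n → Γ) × Γ // IsPartialConj σ τ p.1 p.2.1 p.2.2}
  have hstep (m : ℕ) (p : State) : ∃ q : State, p.1.1 ⊆ q.1.1 ∧
      (∀ a ∈ p.1.1, q.1.2.2⁻¹ * a * q.1.2.2 = p.1.2.2⁻¹ * a * p.1.2.2) ∧ x m ∈ q.1.1 ∧
      ∃ a ∈ q.1.1, q.1.2.2⁻¹ * a * q.1.2.2 = x m := by
    obtain ⟨S, g, c, h, hS, hxS, hc⟩ := p.2.exists_mem hσ hτ' (x m)
    obtain ⟨S', g', c', h', hS', hxS', hc'⟩ := h.exists_conj_mem hσ' hτ (x m)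
    exact ⟨⟨(S', g', c'), h'⟩, hS.trans hS',
      fun a ha => (hc' a (hS ha)).trans (hc a ha), hS' hxS, hxS'⟩
  choose next hsub hagree hdom hran using hstep
  have hinit : IsPartialConj σ τ {1} 1 1 :=
    ⟨fun i => by simp, fun i a ha => by simp_all, fun i a ha => by simp_all⟩
  let s : ℕ → State := fun m => Nat.rec ⟨({1}, 1, 1), hinit⟩ next m
  have hmono : Monotone fun m => (s m).1.1 := monotone_nat_of_le_succ fun m => hsub m (s m)
  obtain ⟨κ, hκ⟩ := exists_mulAut_of_chain (S := fun m => (s m).1.1) (c := fun m => (s m).1.2.2)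
    hmono (fun m k hmk => by
      induction k, hmk using Nat.le_induction with
      | base => exact fun _ _ => rfl
      | succ k hmk ih =>
        exact fun a ha => (hagree k (s k) a (hmono hmk ha)).trans (ih a ha))
    (fun a => by
      obtain ⟨m, rfl⟩ := hx a
      exact ⟨m + 1, hdom m (s m)⟩)
    (fun b => by
      obtain ⟨m, rfl⟩ := hx b
      exact ⟨m + 1, hran m (s m)⟩)
  have hκσ (i : Fin n) (a : Γ) : κ (σ i a) = τ i (κ a) := by
    obtain ⟨m, rfl⟩ := hx a
    -- The finite stages need not be closed under `σ i`, so a stage containing both points is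
    -- required.
    have hm : ∃ M, x m ∈ (s M).1.1 ∧ σ i (x m) ∈ (s M).1.1 := by
      obtain ⟨l, hl⟩ := hx (σ i (x m))
      refine ⟨max (m + 1) (l + 1), hmono (le_max_left _ _) (hdom m (s m)),
        hmono (le_max_right _ _) ?_⟩
      rw [← hl]
      exact hdom l (s l)
    obtain ⟨M, h1, h2⟩ := hm
    rw [hκ M _ h1, hκ M _ h2, (s M).2.apply_conj i _ h1, (s M).2.conjOn i _ h1]
  refine ⟨κ⁻¹, fun i => ?_⟩
  ext a
  rw [inv_inv, MulAut.mul_apply, MulAut.mul_apply, hκσ, MulAut.apply_inv_self]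

end BackAndForth

theorem mainTheorem3 (Γ : Type u) [Group Γ] [Countable Γ]
    (hΓ : IsInnerUltrahomogeneous Γ)
    (hAge : AgeClosedUnderProd Γ ∨ AgeClosedUnderProdInt Γ) :
    HasAmpleGenericAutomorphisms Γ := by
  intro n
  -- Provides the Baire property, by which the comeagre set is nonempty.
  have := polishSpace_mulAut (Γ := Γ)
  have hres := Filter.inter_mem (hΓ.isLocallyInner_mem_residual (n := n))
    (hΓ.isExtensive_mem_residual hAge)
  obtain ⟨σ, hσ, hσ'⟩ := (dense_of_mem_residual hres).nonempty
  refine ⟨σ, Filter.mem_of_superset hres ?_⟩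
  rintro τ ⟨hτ, hτ'⟩
  obtain ⟨k, hk⟩ := exists_conj_of_isExtensive hσ hσ' hτ hτ'
  exact ⟨k, funext hk⟩
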